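/- An instance of the TSP with $m$ drones (TSP-$m$D) consists of a finite node set $N$ with a depot $0\in N$; subsets $N^{tr},N^{dr}\subseteq N$ of nodes that the truck, respectively the drones, can serve, with $0\in N^{tr}$ and $N^{tr}\cup N^{dr}=N$; two metrics $\ell,\ell'$ on $N$ (travel times of the truck and of the drones); a drone weight $w^{dr}>0$, payloads $w_i\ge 0$ and a battery capacity $B>0$. A feasible sortie is a tuple $\pi=(i_1,\dots,i_r)$, $r\ge 3$, of nodes with $i_q\ne i_{q+1}$ for all $q<r$, $i_1,i_r\in N^{tr}$, $i_2,\dots,i_{r-1}\in N^{dr}$ and $$w^{dr}\sum_{q=1}^{r-1}\ell'_{i_qi_{q+1}}+\sum_{p=2}^{r-1}w_{i_p}\sum_{q=1}^{p-1}\ell'_{i_qi_{q+1}}\le B;$$ it serves the customers $i_2,\dots,i_{r-1}$, it lasts $\sum_{q=1}^{r-1}\ell'_{i_qi_{q+1}}$, and it is a loop if $i_1=i_r$. In a feasible solution the truck starts at time $0$ and follows a closed walk from $0$ to $0$ through nodes of $N^{tr}$, possibly waiting at nodes; each of the $m$ drones performs feasible sorties one after the other, being launched by the truck at the first node of the sortie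 and retrieved by the truck at its last node (possibly after waiting there for the truck) while the truck is at that node; and every node is on the truck route or is served in a sortie. The completion time is the time at which the truck has ended its walk at the depot and all drones have been retrieved. Let TSP-$m$D be the minimum completion time, and $m$-CYCLE the minimum completion time over the solutions in which the truck visits no node more than once (except for the final return to the depot). **Proposition.** 1. The bound $m\text{-CYCLE}\le(1+2m)\,\text{TSP-}m\text{D}$ is asymptotically tight for $m=1$: there is a sequence of instances with one drone and positive TSP-1D along which $\frac{1\text{-CYCLE}}{\text{TSP-1D}}\to 1+2\cdot 1=3$. 2. The bound $m\text{-CYCLE}\le(1+m)\,\text{TSP-}m\text{D}$ for instances all of whose feasible sorties are loops or serve only one customer is asymptotically tight for $m=1$: there is a sequence of instances of this kind with one drone and positive TSP-1D along which $\frac{1\text{-CYCLE}}{\text{TSP-1D}}\to 1+1=2$. 3. For every $m\ge 1$ there is an instance with $m$ drones and positive TSP-$m$D such that $\frac{m\text{-CYCLE}}{\text{TSP-}m\text{D}}\ge m$. -/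

import Mathlib

open Filter Topology

/-- An instance of the Traveling Salesman Problem with `m` drones. -/
structure TSPDInstance (m : ℕ) where
  /-- customer locations together with the depot -/
  Node : Type
  finite_node : Finite Node
  depot : Node
  /-- locations that can be served by the truck -/
  Ntr : Set Node
  /-- locations that can be served by the drones -/
  Ndr : Set Node
  depot_mem : depot ∈ Ntr
  union_eq : Ndr ∪ Ntr = Set.univ
  /-- travel times of the truck, a metric -/
  truckTime : Node → Node → ℝ
  truckTime_self : ∀ i, truckTime i i = 0
  truckTime_pos : ∀ i j, i ≠ j → 0 < truckTime i j
  truckTime_symm : ∀ i j, truckTime i j = truckTime j i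
  truckTime_triangle : ∀ i j k, truckTime i k ≤ truckTime i j + truckTime j k
  /-- travel times of the drones, a metric -/
  droneTime : Node → Node → ℝ
  droneTime_self : ∀ i, droneTime i i = 0
  droneTime_pos : ∀ i j, i ≠ j → 0 < droneTime i j
  droneTime_symm : ∀ i j, droneTime i j = droneTime j i
  droneTime_triangle : ∀ i j k, droneTime i k ≤ droneTime i j + droneTime j k
  /-- weight of a single drone -/
  droneWeight : ℝ
  droneWeight_pos : 0 < droneWeight
  /-- payload needed to serve a customer -/
  payload : Node → ℝ
  payload_nonneg : ∀ i, 0 ≤ payload i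
  /-- maximum amount of energy that a sortie may consume -/
  battery : ℝ
  battery_pos : 0 < battery

/-- A sequence of nodes `node 0, node 1, …, node k, node (k + 1)` to be flown by a drone:
`node 0` is the starting node, `node (k + 1)` the ending node, and `node 1, …, node k` are served
in between. The values of `node` beyond `k + 1` play no role. -/
structure Sortie (N : Type) where
  k : ℕ
  node : ℕ → N

namespace Sortie

variable {N : Type}

/-- The node reached at the end of the sortie. -/
def finish (π : Sortie N) : N := π.node (π.k + 1)

/-- A loop starts and ends at the same node. -/
def IsLoop (π : Sortie N) : Prop := π.node 0 = π.finish

/-- The customers served along the sortie. -/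
def served (π : Sortie N) : Set N := {i | ∃ p, 1 ≤ p ∧ p ≤ π.k ∧ π.node p = i}

end Sortie

namespace TSPDInstance

variable {m : ℕ}

/-- The time a drone needs to fly along the sortie. -/
noncomputable def duration (I : TSPDInstance m) (π : Sortie I.Node) : ℝ :=
  ∑ q ∈ Finset.range (π.k + 1), I.droneTime (π.node q) (π.node (q + 1))

/-- The energy needed to fly along the sortie: the weight of the drone is carried all the way, the
payload of a customer from the starting node to that customer. -/
noncomputable def energy (I : TSPDInstance m) (π : Sortie I.Node) : ℝ :=
  I.droneWeight * I.duration π +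
    ∑ p ∈ Finset.Icc 1 π.k, I.payload (π.node p) *
      ∑ q ∈ Finset.range p, I.droneTime (π.node q) (π.node (q + 1))

/-- Feasible sorties: at least one customer is served, the endpoints can be visited by the truck,
the intermediate nodes can be served by drones, consecutive nodes are joined by an arc of the
complete directed graph (that is, they are distinct), and the battery suffices. -/
structure FeasibleSortie (I : TSPDInstance m) (π : Sortie I.Node) : Prop where
  one_le : 1 ≤ π.k
  start_mem : π.node 0 ∈ I.Ntr
  finish_mem : π.finish ∈ I.Ntr
  served_subset : π.served ⊆ I.Ndr
  arcs : ∀ q ≤ π.k, π.node q ≠ π.node (q + 1)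
  energy_le : I.energy π ≤ I.battery

/-- A flight of one drone: the sortie, the positions in the truck route at which the drone is
launched from and retrieved by the truck, and the times at which this happens. -/
structure Flight (N : Type) where
  sortie : Sortie N
  launchPos : ℕ
  retrievePos : ℕ
  launchTime : ℝ
  retrieveTime : ℝ

/-- A feasible solution. The truck follows the closed walk `route 0, …, route n`; it is at
`route p` from time `arrival p` to time `departure p`, so it may wait at every node of its route.
Each drone performs a list of flights, one after the other. A drone may have to wait for the truck
after completing its sortie, and it is on board of the truck between its flights. (The values of
`route`, `arrival` and `departure` beyond `n` play no role.) -/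
structure Solution (I : TSPDInstance m) where
  n : ℕ
  route : ℕ → I.Node
  route_start : route 0 = I.depot
  route_end : route n = I.depot
  route_mem : ∀ p ≤ n, route p ∈ I.Ntr
  route_arcs : ∀ p < n, route p ≠ route (p + 1)
  arrival : ℕ → ℝ
  departure : ℕ → ℝ
  arrival_zero : arrival 0 = 0
  wait : ∀ p ≤ n, arrival p ≤ departure p
  travel : ∀ p < n, arrival (p + 1) = departure p + I.truckTime (route p) (route (p + 1))
  flights : Fin m → List (Flight I.Node)
  feasible : ∀ d, ∀ f ∈ flights d, I.FeasibleSortie f.sortie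
  /-- the drone is launched at the starting node of the sortie while the truck is there -/
  launch : ∀ d, ∀ f ∈ flights d, f.launchPos ≤ n ∧ route f.launchPos = f.sortie.node 0 ∧
    arrival f.launchPos ≤ f.launchTime ∧ f.launchTime ≤ departure f.launchPos
  /-- the drone is retrieved at the ending node of the sortie while the truck is there -/
  retrieve : ∀ d, ∀ f ∈ flights d, f.retrievePos ≤ n ∧ route f.retrievePos = f.sortie.finish ∧
    arrival f.retrievePos ≤ f.retrieveTime ∧ f.retrieveTime ≤ departure f.retrievePos
  /-- there is enough time to fly along the sortie -/
  fly : ∀ d, ∀ f ∈ flights d, f.launchTime + I.duration f.sortie ≤ f.retrieveTime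
  /-- the flights of one drone do not overlap -/
  disjoint : ∀ d, (flights d).Pairwise fun f g => f.retrieveTime ≤ g.launchTime
  /-- every node is on the truck route or served by a drone -/
  cover : ∀ i, (∃ p ≤ n, route p = i) ∨ ∃ d, ∃ f ∈ flights d, i ∈ f.sortie.served

/-- The time at which everything is completed: all flights are over, and the truck, with all the
drones on board, is at the depot at the end of its route. -/
def Solution.completionTime {I : TSPDInstance m} (S : I.Solution) : ℝ := S.departure S.n

/-- The truck route is a cycle: no node is visited more than once (the return to the depot at
the end of the route is not counted). -/
def Solution.IsCycle {I : TSPDInstance m} (S : I.Solution) : Prop :=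
  ∀ p < S.n, ∀ q < S.n, S.route p = S.route q → p = q

/-- The optimal value `TSP-mD`. -/
noncomputable def tspmD (I : TSPDInstance m) : ℝ :=
  sInf {t | ∃ S : I.Solution, S.completionTime = t}

/-- The optimal value `m-CYCLE` of the restriction to truck routes that do not revisit nodes. -/
noncomputable def mCycle (I : TSPDInstance m) : ℝ :=
  sInf {t | ∃ S : I.Solution, S.IsCycle ∧ S.completionTime = t}

/-- Every feasible sortie is a loop or serves only one customer. -/
def LoopOrSingle (I : TSPDInstance m) : Prop :=
  ∀ π : Sortie I.Node, I.FeasibleSortie π → π.IsLoop ∨ π.k = 1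

end TSPDInstance

/-! A truck that may not return to a node has to wait wherever a drone flies a loop, and it can go
from one launching node to the other only a bounded number of times. Two families of instances make
this as expensive as possible. In both, the optimal values are enclosed by explicit bounds: lower
ones from counting, upper ones from concrete solutions. Upper bounds on `mCycle` are needed as well,
since the limits are obtained by squeezing and not from a general ratio bound.

In `loopInstance` the battery only allows loops of duration 1 from a site to its own customer, and
the truck needs time 1 to reach a remote node and return. With revisits, it drops a drone at each of
the `m` sites, makes this trip and collects the drones: time `1 + 2mε`. On a cycle, launch and
retrieval happen during a single stay, so the `m` unit waits add up and the time is at least `1 +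
m`. Letting `ε → 0` with `m = 1` gives ratio 2; a small fixed `ε` gives ratio at least `m` for every
`m`.

In `pathInstance` the truck must visit `K` remote nodes, at cost at least `K`, while one drone
serves `2K` customers, two in a flight from hub to hub but only one in a loop. Shuttling between the
hubs takes `K(1 + ε)`. On a cycle (`le_of_isCycle`) the potential "time waited plus twice the number
of hub stays passed" grows in each flight by at least the number of customers served, and the hub
stays contribute at most 4 in total. Hence the truck waits at least `2K - 4`, and the completion
time is at least `3K - 4`, against `3K + 1` for an explicit cycle. With `K → ∞` and `ε → 0` the
ratio tends to 3. -/

/-- Consecutive increments telescope and the gaps between them only help: after the head is removed,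
`b f` serves as the new lower end. The functions `a` and `b` are arbitrary so that potentials can
replace clock times. -/
theorem List.sum_map_sub_le {α : Type*} (a b : α → ℝ) {hi : ℝ} (L : List α) :
    ∀ lo : ℝ, lo ≤ hi → (∀ f ∈ L, lo ≤ a f) → (∀ f ∈ L, b f ≤ hi) →
      L.Pairwise (fun f g => b f ≤ a g) → (L.map fun f => b f - a f).sum ≤ hi - lo := by
  induction L with
  | nil => intro lo h _ _ _; simpa using h
  | cons f L ih =>
    intro lo _ ha hb hp
    rw [List.pairwise_cons] at hp
    have := ih (b f) (hb f (by simp)) hp.1 (fun g hg => hb g (by simp [hg])) hp.2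
    have := ha f (by simp)
    simp only [List.map_cons, List.sum_cons]
    linarith

/-! ### Waiting time, travel time and counting bounds for arbitrary solutions -/

namespace TSPDInstance

variable {m : ℕ} {I : TSPDInstance m}

theorem truckTime_nonneg (I : TSPDInstance m) (i j : I.Node) : 0 ≤ I.truckTime i j := by
  by_cases h : i = j
  · rw [h, I.truckTime_self]
  · exact (I.truckTime_pos i j h).le

theorem droneTime_nonneg (I : TSPDInstance m) (i j : I.Node) : 0 ≤ I.droneTime i j := by
  by_cases h : i = j
  · rw [h, I.droneTime_self]
  · exact (I.droneTime_pos i j h).le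

theorem duration_nonneg (I : TSPDInstance m) (π : Sortie I.Node) : 0 ≤ I.duration π :=
  Finset.sum_nonneg fun _ _ => I.droneTime_nonneg _ _

namespace Solution

/-- The time the truck spends on the first `p` arcs of its route. -/
noncomputable def travelTime (S : I.Solution) (p : ℕ) : ℝ :=
  ∑ q ∈ Finset.range p, I.truckTime (S.route q) (S.route (q + 1))

/-- At time `t` the truck stands at position `p` of its route. -/
def StandsAt (S : I.Solution) (p : ℕ) (t : ℝ) : Prop :=
  p ≤ S.n ∧ S.arrival p ≤ t ∧ t ≤ S.departure p

theorem travelTime_succ (S : I.Solution) (p : ℕ) :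
    S.travelTime (p + 1) = S.travelTime p + I.truckTime (S.route p) (S.route (p + 1)) :=
  Finset.sum_range_succ _ _

theorem arrival_eq (S : I.Solution) {p : ℕ} (hp : p ≤ S.n) :
    S.arrival p = ∑ q ∈ Finset.range p, (S.departure q - S.arrival q) + S.travelTime p := by
  induction p with
  | zero => simp [travelTime, S.arrival_zero]
  | succ p ih =>
    rw [S.travel p hp, Finset.sum_range_succ, travelTime_succ]
    linarith [ih (by omega)]

theorem travelTime_mono (S : I.Solution) : Monotone S.travelTime :=
  monotone_nat_of_le_succ fun p => by
    rw [travelTime_succ]; linarith [I.truckTime_nonneg (S.route p) (S.route (p + 1))]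

theorem departure_add_le (S : I.Solution) {p q : ℕ} (hpq : p < q) (hq : q ≤ S.n) :
    S.departure p + (S.travelTime q - S.travelTime p) ≤ S.arrival q := by
  induction q, hpq using Nat.le_induction with
  | base => rw [S.travel p hq, travelTime_succ]; linarith
  | succ q hpq ih =>
    rw [S.travel q hq, travelTime_succ]
    linarith [ih (by omega), S.wait q (by omega)]

/-- Consecutive route nodes differ, so every leg takes positive time. Strictness makes the position
of a standing truck a monotone function of time. -/
theorem departure_lt_arrival (S : I.Solution) {p q : ℕ} (hpq : p < q) (hq : q ≤ S.n) :
    S.departure p < S.arrival q := by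
  have h := S.departure_add_le hpq hq
  have h' := S.travelTime_mono (Nat.succ_le_of_lt hpq)
  rw [Nat.succ_eq_add_one, travelTime_succ] at h'
  linarith [I.truckTime_pos _ _ (S.route_arcs p (by omega))]

theorem StandsAt.le_of_le {S : I.Solution} {p q : ℕ} {t u : ℝ} (hp : S.StandsAt p t)
    (hq : S.StandsAt q u) (h : t ≤ u) : p ≤ q := by
  by_contra! hlt
  linarith [S.departure_lt_arrival hlt hp.1, hp.2.1, hq.2.2]

/-- The difference `t - S.travelTime p` is the time waited up to `t`, which cannot decrease. -/
theorem StandsAt.sub_travelTime_le {S : I.Solution} {p q : ℕ} {t u : ℝ} (hp : S.StandsAt p t)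
    (hq : S.StandsAt q u) (h : t ≤ u) : t - S.travelTime p ≤ u - S.travelTime q := by
  rcases (hp.le_of_le hq h).eq_or_lt with rfl | hlt
  · linarith
  · linarith [S.departure_add_le hlt hq.1, hp.2.2, hq.2.1]

theorem standsAt_zero (S : I.Solution) : S.StandsAt 0 0 :=
  ⟨Nat.zero_le _, S.arrival_zero.le, S.arrival_zero ▸ S.wait 0 (Nat.zero_le _)⟩

theorem standsAt_end (S : I.Solution) : S.StandsAt S.n S.completionTime :=
  ⟨le_rfl, S.wait _ le_rfl, le_rfl⟩

theorem standsAt_launch (S : I.Solution) {d : Fin m} {f : Flight I.Node} (hf : f ∈ S.flights d) :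
    S.StandsAt f.launchPos f.launchTime :=
  ⟨(S.launch d f hf).1, (S.launch d f hf).2.2⟩

theorem standsAt_retrieve (S : I.Solution) {d : Fin m} {f : Flight I.Node}
    (hf : f ∈ S.flights d) : S.StandsAt f.retrievePos f.retrieveTime :=
  ⟨(S.retrieve d f hf).1, (S.retrieve d f hf).2.2⟩

theorem StandsAt.nonneg {S : I.Solution} {p : ℕ} {t : ℝ} (h : S.StandsAt p t) : 0 ≤ t := by
  rcases p.eq_zero_or_pos with rfl | hp
  · linarith [h.2.1, S.arrival_zero]
  · linarith [h.2.1, S.departure_lt_arrival hp h.1, S.wait 0 (Nat.zero_le _), S.arrival_zero]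

theorem StandsAt.le_completionTime {S : I.Solution} {p : ℕ} {t : ℝ} (h : S.StandsAt p t) :
    t ≤ S.completionTime := by
  rcases h.1.eq_or_lt with rfl | hp
  · exact h.2.2
  · have := S.wait S.n le_rfl
    unfold completionTime
    linarith [h.2.2, S.departure_lt_arrival hp le_rfl]

theorem launchTime_le (S : I.Solution) {d : Fin m} {f : Flight I.Node} (hf : f ∈ S.flights d) :
    f.launchTime ≤ f.retrieveTime := by
  linarith [S.fly d f hf, I.duration_nonneg f.sortie]

theorem travelTime_le_completionTime (S : I.Solution) :
    S.travelTime S.n ≤ S.completionTime := by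
  have := S.standsAt_zero.sub_travelTime_le S.standsAt_end S.standsAt_zero.le_completionTime
  simp only [travelTime, Finset.range_zero, Finset.sum_empty] at this ⊢
  linarith

/-- A monotone function of the position in the route, added to the time the truck has spent
waiting, telescopes along the flights of a drone. -/
theorem sum_flights_le (S : I.Solution) (d : Fin m) {P : ℕ → ℝ} (hP : Monotone P) :
    ((S.flights d).map fun f => (f.retrieveTime - S.travelTime f.retrievePos + P f.retrievePos) -
      (f.launchTime - S.travelTime f.launchPos + P f.launchPos)).sum ≤
      (S.completionTime - S.travelTime S.n + P S.n) - P 0 := by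
  have key : ∀ {p q : ℕ} {t u : ℝ}, S.StandsAt p t → S.StandsAt q u → t ≤ u →
      t - S.travelTime p + P p ≤ u - S.travelTime q + P q := fun hp hq h =>
    add_le_add (hp.sub_travelTime_le hq h) (hP (hp.le_of_le hq h))
  have zero : 0 - S.travelTime 0 + P 0 = P 0 := by simp [travelTime]
  refine List.sum_map_sub_le
    (fun f : Flight I.Node => f.launchTime - S.travelTime f.launchPos + P f.launchPos)
    (fun f : Flight I.Node => f.retrieveTime - S.travelTime f.retrievePos + P f.retrievePos)
    _ _ ?_ ?_ ?_ ?_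
  · rw [← zero]
    exact key S.standsAt_zero S.standsAt_end S.standsAt_end.nonneg
  · intro f hf
    rw [← zero]
    exact key S.standsAt_zero (S.standsAt_launch hf) (S.standsAt_launch hf).nonneg
  · intro f hf
    exact key (S.standsAt_retrieve hf) S.standsAt_end (S.standsAt_retrieve hf).le_completionTime
  · exact (S.disjoint d).imp_of_mem fun hf hg h =>
      key (S.standsAt_retrieve hf) (S.standsAt_launch hg) h

theorem exists_route_eq (S : I.Solution) {i : I.Node} (hi : i ∉ I.Ndr) (h0 : i ≠ I.depot) :
    ∃ p < S.n, S.route p = i := by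
  rcases S.cover i with ⟨p, hp, rfl⟩ | ⟨d, f, hf, h⟩
  · exact ⟨p, lt_of_le_of_ne hp fun h => h0 (h ▸ S.route_end), rfl⟩
  · exact absurd ((S.feasible d f hf).served_subset h) hi

theorem exists_served (S : I.Solution) {i : I.Node} (hi : i ∉ I.Ntr) :
    ∃ d, ∃ f ∈ S.flights d, i ∈ f.sortie.served :=
  (S.cover i).resolve_left fun ⟨p, hp, h⟩ => hi (h ▸ S.route_mem p hp)

/-- If arriving at and leaving a node `i` costs at least `h i` each, then the truck travels at
least twice the total of `h` over nodes that only the truck can serve. -/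
theorem two_mul_sum_le_travelTime (S : I.Solution) {h : I.Node → ℝ} (h0 : ∀ i, 0 ≤ h i)
    (hd : ∀ i j, i ≠ j → h i + h j ≤ I.truckTime i j) (Z : Finset I.Node)
    (hZ : ∀ z ∈ Z, z ∉ I.Ndr ∧ z ≠ I.depot) :
    2 * ∑ z ∈ Z, h z ≤ S.travelTime S.n := by
  classical
  have h1 : ∑ z ∈ Z, h z ≤ ∑ p ∈ Finset.range S.n, h (S.route p) := by
    refine le_trans (Finset.sum_le_sum_of_subset_of_nonneg
      (t := (Finset.range S.n).image S.route) ?_ fun i _ _ => h0 i)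
      (Finset.sum_image_le_of_nonneg fun i _ => h0 _)
    intro z hz
    obtain ⟨p, hp, rfl⟩ := S.exists_route_eq (hZ z hz).1 (hZ z hz).2
    exact Finset.mem_image_of_mem _ (Finset.mem_range.2 hp)
  -- The walk is closed, so summing over the heads of its arcs gives the same as summing over the
  -- tails.
  have h2 : ∑ p ∈ Finset.range S.n, h (S.route (p + 1)) =
      ∑ p ∈ Finset.range S.n, h (S.route p) := by
    have := (Finset.sum_range_succ (fun p => h (S.route p)) S.n).symm.trans
      (Finset.sum_range_succ' _ _)
    rw [S.route_start, S.route_end] at this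
    linarith
  have h3 : ∑ p ∈ Finset.range S.n, (h (S.route p) + h (S.route (p + 1))) ≤ S.travelTime S.n :=
    Finset.sum_le_sum fun p hp => hd _ _ (S.route_arcs p (Finset.mem_range.1 hp))
  rw [Finset.sum_add_distrib, h2] at h3
  linarith

/-- The customers served by a drone are at most as many as the stops of its sorties. -/
theorem card_le_sum_flights (S : I.Solution) (d : Fin m) (C : Finset I.Node)
    (hC : ∀ c ∈ C, ∃ f ∈ S.flights d, c ∈ f.sortie.served) :
    (C.card : ℝ) ≤ ((S.flights d).map fun f => (f.sortie.k : ℝ)).sum := by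
  classical
  have hsub : C ⊆ ((S.flights d).flatMap fun f =>
      (List.range f.sortie.k).map fun q => f.sortie.node (q + 1)).toFinset := by
    intro c hc
    obtain ⟨f, hf, p, hp1, hp2, rfl⟩ := hC c hc
    simp only [List.mem_toFinset, List.mem_flatMap, List.mem_map, List.mem_range]
    exact ⟨f, hf, p - 1, by omega, by rw [Nat.sub_add_cancel hp1]⟩
  have h := (Finset.card_le_card hsub).trans (List.toFinset_card_le _)
  rw [List.length_flatMap] at h
  simp only [List.length_map, List.length_range] at h
  have h' : (C.card : ℝ) ≤ (((S.flights d).map fun f => f.sortie.k).sum : ℕ) := by exact_mod_cast h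
  rwa [Nat.cast_list_sum, List.map_map] at h'

theorem tspmD_le (S : I.Solution) : I.tspmD ≤ S.completionTime :=
  csInf_le ⟨0, by rintro _ ⟨S, rfl⟩; exact S.standsAt_end.nonneg⟩ ⟨S, rfl⟩

theorem mCycle_le (S : I.Solution) (hS : S.IsCycle) : I.mCycle ≤ S.completionTime :=
  csInf_le ⟨0, by rintro _ ⟨S, _, rfl⟩; exact S.standsAt_end.nonneg⟩ ⟨S, hS, rfl⟩

/-- The real infimum of the empty set is 0, so a lower bound needs the witness `S₀` that solutions
exist. -/
theorem le_tspmD (S₀ : I.Solution) {t : ℝ} (h : ∀ S : I.Solution, t ≤ S.completionTime) :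
    t ≤ I.tspmD :=
  le_csInf ⟨_, S₀, rfl⟩ (by rintro _ ⟨S, rfl⟩; exact h S)

theorem le_mCycle (S₀ : I.Solution) (h₀ : S₀.IsCycle) {t : ℝ}
    (h : ∀ S : I.Solution, S.IsCycle → t ≤ S.completionTime) : t ≤ I.mCycle :=
  le_csInf ⟨_, S₀, h₀, rfl⟩ (by rintro _ ⟨S, hS, rfl⟩; exact h S hS)

end Solution

end TSPDInstance

/-! ### Two shapes of sorties -/

/-- The sortie that serves the customer `c` from `a` and returns to `a`. -/
def Sortie.singleLoop {N : Type} (a c : N) : Sortie N where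
  k := 1
  node q := if q = 1 then c else a

/-- The sortie that starts at `a`, serves `c` and `d`, and ends at `b`. -/
def Sortie.pair {N : Type} (a c d b : N) : Sortie N where
  k := 2
  node q := if q = 0 then a else if q = 1 then c else if q = 2 then d else b

namespace Sortie

variable {N : Type}

theorem singleLoop_served (a c : N) : (singleLoop a c).served = {c} := by
  ext i
  constructor
  · rintro ⟨p, h1, h2, rfl⟩
    obtain rfl : p = 1 := le_antisymm h2 h1
    simp [singleLoop]
  · rintro rfl
    exact ⟨1, le_rfl, le_rfl, by simp [singleLoop]⟩

theorem pair_served (a c d b : N) : (pair a c d b).served = {c, d} := by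
  ext i
  constructor
  · rintro ⟨p, h1, h2, rfl⟩
    simp only [pair] at h2
    interval_cases p <;> simp [pair]
  · rintro (rfl | rfl)
    · exact ⟨1, le_rfl, by simp [pair], by simp [pair]⟩
    · exact ⟨2, by simp, by simp [pair], by simp [pair]⟩

end Sortie

/-! ### Instances whose only sorties are loops -/

/-- A depot, a remote node, and `m` sites with one customer each. -/
inductive LoopNode (m : ℕ) where
  | base
  | far
  | site (i : Fin m)
  | cust (i : Fin m)
  deriving DecidableEq, Fintype

namespace LoopNode

variable {m : ℕ}

/-- The depot and the sites are close to each other. -/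
def IsNear : LoopNode m → Prop
  | base => True
  | site _ => True
  | _ => False

instance : DecidablePred (IsNear (m := m)) := fun x => by
  cases x <;> unfold IsNear <;> infer_instance

/-- A site and its customer. -/
def Linked : LoopNode m → LoopNode m → Prop
  | site i, cust j => i = j
  | cust i, site j => i = j
  | _, _ => False

instance : DecidableRel (Linked (m := m)) := fun x y => by
  cases x <;> cases y <;> unfold Linked <;> infer_instance

theorem Linked.symm {x y : LoopNode m} (h : Linked x y) : Linked y x := by
  cases x <;> cases y <;> simp_all [Linked]

noncomputable def truckDist (ε : ℝ) (x y : LoopNode m) : ℝ :=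
  if x = y then 0 else if IsNear x ∧ IsNear y then ε else 1 / 2

noncomputable def droneDist (x y : LoopNode m) : ℝ :=
  if x = y then 0 else if Linked x y then 1 / 2 else 1

theorem half_le_droneDist {x y : LoopNode m} (h : x ≠ y) : 1 / 2 ≤ droneDist x y := by
  unfold droneDist
  split_ifs <;> first | contradiction | norm_num

theorem linked_of_droneDist_lt {x y : LoopNode m} (h : x ≠ y) (hd : droneDist x y < 1) :
    Linked x y := by
  by_contra hl
  simp [droneDist, h, hl] at hd

theorem truckDist_of_near {x y : LoopNode m} (ε : ℝ) (hx : IsNear x) (hy : IsNear y)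
    (h : x ≠ y) : truckDist ε x y = ε := by
  rw [truckDist, if_neg h, if_pos ⟨hx, hy⟩]

theorem truckDist_far_left {x : LoopNode m} (ε : ℝ) (h : far ≠ x) :
    truckDist ε far x = 1 / 2 := by
  rw [truckDist, if_neg h, if_neg fun h => h.1]

theorem truckDist_far_right {x : LoopNode m} (ε : ℝ) (h : x ≠ far) :
    truckDist ε x far = 1 / 2 := by
  rw [truckDist, if_neg h, if_neg fun h => h.2]

theorem droneDist_site_cust (i : Fin m) : droneDist (site i) (cust i) = 1 / 2 := by
  simp [droneDist, Linked]

theorem droneDist_cust_site (i : Fin m) : droneDist (cust i) (site i) = 1 / 2 := by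
  simp [droneDist, Linked]

end LoopNode

open LoopNode in
/-- The truck travels within time `ε` between the depot and the sites; the only feasible sorties
are the loops of duration `1` from a site to its customer. -/
noncomputable abbrev loopInstance (m : ℕ) {ε : ℝ} (h0 : 0 < ε) (h1 : ε ≤ 1 / 2) :
    TSPDInstance m where
  Node := LoopNode m
  finite_node := inferInstance
  depot := base
  Ntr := {x | ∀ i, x ≠ cust i}
  Ndr := {x | ∃ i, x = cust i}
  depot_mem := by simp
  union_eq := by
    ext x
    simpa using em (∃ i, x = cust i)
  truckTime := truckDist ε
  truckTime_self := by simp [truckDist]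
  truckTime_pos i j h := by
    unfold truckDist
    split_ifs <;> first | positivity | contradiction
  truckTime_symm i j := by simp only [truckDist, eq_comm, and_comm]
  truckTime_triangle i j k := by
    unfold truckDist
    split_ifs <;> first | linarith | (exfalso; simp_all)
  droneTime := droneDist
  droneTime_self := by simp [droneDist]
  droneTime_pos i j h := by linarith [half_le_droneDist h]
  droneTime_symm i j := by
    have : Linked i j ↔ Linked j i := ⟨Linked.symm, Linked.symm⟩
    simp only [droneDist, eq_comm, this]
  droneTime_triangle i j k := by
    by_cases hij : i = j
    · subst hij; simp [droneDist]
    by_cases hjk : j = k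
    · subst hjk; simp [droneDist]
    have : droneDist i k ≤ 1 := by unfold droneDist; split_ifs <;> norm_num
    linarith [half_le_droneDist hij, half_le_droneDist hjk]
  droneWeight := 1
  droneWeight_pos := one_pos
  payload _ := 0
  payload_nonneg _ := le_rfl
  battery := 1
  battery_pos := one_pos

namespace loopInstance

open LoopNode TSPDInstance

variable {m : ℕ} {ε : ℝ} {h0 : 0 < ε} {h1 : ε ≤ 1 / 2}

theorem energy_eq (π : Sortie (LoopNode m)) :
    (loopInstance m h0 h1).energy π = (loopInstance m h0 h1).duration π := by
  simp [energy, loopInstance]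

theorem duration_singleLoop (i : Fin m) :
    (loopInstance m h0 h1).duration (Sortie.singleLoop (site i) (cust i)) = 1 := by
  simp only [duration, loopInstance, Sortie.singleLoop, Finset.sum_range_succ]
  norm_num [droneDist_site_cust, droneDist_cust_site]

theorem feasibleSortie_singleLoop (i : Fin m) :
    (loopInstance m h0 h1).FeasibleSortie (Sortie.singleLoop (site i) (cust i)) where
  one_le := le_rfl
  start_mem := by simp [loopInstance, Sortie.singleLoop]
  finish_mem := by simp [loopInstance, Sortie.singleLoop, Sortie.finish]
  served_subset := by
    rw [Sortie.singleLoop_served]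
    simp [loopInstance]
  arcs q hq := by
    simp only [Sortie.singleLoop] at hq ⊢
    interval_cases q <;> simp
  energy_le := by rw [energy_eq, duration_singleLoop]

/-- Every leg lasts at least 1/2 and the battery allows 1, so there are exactly two legs of length
1/2, and only a site and its own customer are that close. -/
theorem FeasibleSortie.eq_singleLoop {π : Sortie (LoopNode m)}
    (h : (loopInstance m h0 h1).FeasibleSortie π) :
    π.k = 1 ∧ ∃ i, π.node 0 = site i ∧ π.node 1 = cust i ∧ π.node 2 = site i := by
  have hle : (loopInstance m h0 h1).duration π ≤ 1 := by
    rw [← energy_eq]; exact h.energy_le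
  have hd : ∀ q ≤ π.k, 1 / 2 ≤ droneDist (π.node q) (π.node (q + 1)) :=
    fun q hq => half_le_droneDist (h.arcs q hq)
  have hk : π.k = 1 := by
    have : ∑ q ∈ Finset.range (π.k + 1), (1 / 2 : ℝ) ≤ (loopInstance m h0 h1).duration π :=
      Finset.sum_le_sum fun q hq => hd q (by simpa [Nat.lt_succ_iff] using hq)
    rw [Finset.sum_const, Finset.card_range, nsmul_eq_mul] at this
    have h2 : (π.k : ℝ) ≤ 1 := by push_cast at this; linarith
    exact le_antisymm (by exact_mod_cast h2) h.one_le
  refine ⟨hk, ?_⟩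
  obtain ⟨i, hi⟩ : ∃ i, π.node 1 = cust i := h.served_subset ⟨1, le_rfl, hk.ge, rfl⟩
  have e0 := hd 0 (by omega)
  have e1 := hd 1 (by omega)
  have hsum : droneDist (π.node 0) (π.node 1) + droneDist (π.node 1) (π.node 2) ≤ 1 := by
    simpa [duration, hk, Finset.sum_range_succ] using hle
  have l0 := linked_of_droneDist_lt (h.arcs 0 (by omega)) (by norm_num at *; linarith)
  have l1 := linked_of_droneDist_lt (h.arcs 1 (by omega)) (by norm_num at *; linarith)
  norm_num [hi] at l0 l1
  refine ⟨i, ?_, hi, ?_⟩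
  · rcases hx : π.node 0 with _ | _ | j | j <;> simp_all [Linked]
  · rcases hx : π.node 2 with _ | _ | j | j <;> simp_all [Linked]

theorem loopOrSingle : (loopInstance m h0 h1).LoopOrSingle := fun _ h =>
  Or.inr (FeasibleSortie.eq_singleLoop h).1

/-- The truck has to travel to the remote node and back. -/
theorem one_le_travelTime (S : (loopInstance m h0 h1).Solution) : 1 ≤ S.travelTime S.n := by
  have h := S.two_mul_sum_le_travelTime (h := fun x : LoopNode m => if x = far then 1 / 2 else 0)
    (fun i => by split_ifs <;> norm_num) (fun i j hij => ?_) {far} ?_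
  · simpa using h
  · rcases i with _ | _ | i | i <;> rcases j with _ | _ | j | j <;>
      simp_all [loopInstance, truckDist, IsNear] <;> linarith
  · simp [loopInstance]

/-- While a drone flies from a site, a truck that does not revisit the site waits there. -/
theorem exists_wait (S : (loopInstance m h0 h1).Solution) (hS : S.IsCycle) (i : Fin m) :
    ∃ p < S.n, S.route p = site i ∧ 1 ≤ S.departure p - S.arrival p := by
  obtain ⟨d, f, hf, hserved⟩ := S.exists_served (i := cust i) (by simp [loopInstance])
  obtain ⟨hk, j, hj0, hj1, hj2⟩ := FeasibleSortie.eq_singleLoop (S.feasible d f hf)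
  obtain rfl : j = i := by
    obtain ⟨p, hp1, hp2, hp⟩ := hserved
    obtain rfl : p = 1 := by omega
    simpa [hj1] using hp
  have hend : S.route S.n = base := S.route_end
  have hl := S.launch d f hf
  have hr := S.retrieve d f hf
  simp only [Sortie.finish, hk, hj0, hj2] at hl hr
  -- The last position is the depot and not a site, so both positions lie in the range to which
  -- `IsCycle` applies.
  have hln : f.launchPos < S.n := lt_of_le_of_ne hl.1 fun h => by simp [h, hend] at hl
  have hrn : f.retrievePos < S.n := lt_of_le_of_ne hr.1 fun h => by simp [h, hend] at hr
  have heq := hS _ hln _ hrn (hl.2.1.trans hr.2.1.symm)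
  refine ⟨_, hln, hl.2.1, ?_⟩
  have hdur : (loopInstance m h0 h1).duration f.sortie = 1 := by
    simp only [duration, hk, Finset.sum_range_succ]
    norm_num [hj0, hj1, hj2, droneDist_site_cust, droneDist_cust_site]
  have := S.fly d f hf
  rw [← heq] at hr
  linarith [hl.2.2.1, hr.2.2.2]

theorem one_add_le_of_isCycle (S : (loopInstance m h0 h1).Solution) (hS : S.IsCycle) :
    1 + (m : ℝ) ≤ S.completionTime := by
  choose p hp hsite hwait using exists_wait S hS
  have hinj : Function.Injective p := fun i j h => by
    have := (hsite i).symm.trans ((congrArg S.route h).trans (hsite j))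
    simpa using this
  have h2 : (m : ℝ) ≤ ∑ q ∈ Finset.range S.n, (S.departure q - S.arrival q) :=
    calc (m : ℝ) = ∑ _i : Fin m, (1 : ℝ) := by simp
      _ ≤ ∑ i : Fin m, (S.departure (p i) - S.arrival (p i)) :=
        Finset.sum_le_sum fun i _ => hwait i
      _ = ∑ q ∈ Finset.univ.map ⟨p, hinj⟩, (S.departure q - S.arrival q) := by simp
      _ ≤ _ := Finset.sum_le_sum_of_subset_of_nonneg
        (by
          intro q hq
          obtain ⟨i, -, rfl⟩ := Finset.mem_map.1 hq
          exact Finset.mem_range.2 (hp i))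
        fun q hq _ => sub_nonneg.2 (S.wait q (Finset.mem_range.1 hq).le)
  have h3 := S.arrival_eq le_rfl
  have h4 : S.arrival S.n ≤ S.completionTime := S.wait _ le_rfl
  linarith [one_le_travelTime S]

/-! ### Explicit solutions of the loop instances -/

section Solutions

/-- The truck route that passes the sites, visits the remote node and returns. -/
def cycleRoute (m p : ℕ) : LoopNode m :=
  if h : 1 ≤ p ∧ p ≤ m then site ⟨p - 1, by omega⟩ else if p = m + 1 then far else base

theorem cycleRoute_site {i : ℕ} (h : i < m) : cycleRoute m (i + 1) = site ⟨i, h⟩ := by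
  rw [cycleRoute, dif_pos (by omega)]
  rfl

theorem cycleRoute_far : cycleRoute m (m + 1) = far := by
  rw [cycleRoute, dif_neg (by omega), if_pos rfl]

/-- The truck waits one unit at each site, at positions `1, …, m`. Position 0 is separate because
there is no wait at the depot. -/
noncomputable def cycleArrival (m : ℕ) (ε : ℝ) (p : ℕ) : ℝ :=
  if p = 0 then 0 else if p ≤ m then p * ε + (p - 1) else m * ε + m + (p - m) / 2

noncomputable def cycleDeparture (m : ℕ) (ε : ℝ) (p : ℕ) : ℝ :=
  if p ≤ m then p * ε + p else m * ε + m + (p - m) / 2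

theorem cycleArrival_succ (hm : 1 ≤ m) {p : ℕ} (hp : p < m + 2) :
    cycleArrival m ε (p + 1) = cycleDeparture m ε p +
      truckDist ε (cycleRoute m p) (cycleRoute m (p + 1)) := by
  unfold cycleArrival cycleDeparture
  rw [if_neg (by omega)]
  rcases lt_trichotomy p m with h | rfl | h
  · rw [if_pos (by omega), if_pos (by omega), cycleRoute_site h, truckDist_of_near _ ?_ ?_ ?_]
    · push_cast; ring
    · unfold cycleRoute
      split_ifs <;> first | omega | trivial
    · trivial
    · unfold cycleRoute
      split_ifs <;> simp
      omega
  · rw [if_neg (by omega), if_pos le_rfl, cycleRoute_far, truckDist_far_right]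
    · push_cast; ring
    · unfold cycleRoute
      split_ifs <;> simp
      omega
  · obtain rfl : p = m + 1 := by omega
    rw [if_neg (by omega), if_neg (by omega), cycleRoute_far, truckDist_far_left]
    · push_cast; ring
    · unfold cycleRoute
      split_ifs <;> simp
      omega

variable (h0 h1)

/-- The truck waits at each site until the drone has returned. -/
noncomputable def cycleSolution (hm : 1 ≤ m) :
    (loopInstance m h0 h1).Solution where
  n := m + 2
  route := cycleRoute m
  route_start := by simp [cycleRoute, loopInstance]
  route_end := by simp [cycleRoute, loopInstance]
  route_mem p hp := by
    unfold cycleRoute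
    split_ifs <;> simp [loopInstance]
  route_arcs p hp := by
    unfold cycleRoute
    split_ifs <;> simp <;> omega
  arrival := cycleArrival m ε
  departure := cycleDeparture m ε
  arrival_zero := by simp [cycleArrival]
  wait p hp := by
    unfold cycleArrival cycleDeparture
    split_ifs <;> first | linarith | (subst_vars; simp)
  travel p hp := cycleArrival_succ hm hp
  flights d := [⟨Sortie.singleLoop (site d) (cust d), d + 1, d + 1, (d + 1) * ε + d,
    (d + 1) * ε + d + 1⟩]
  feasible d f hf := by
    rw [List.mem_singleton] at hf
    subst hf
    exact feasibleSortie_singleLoop d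
  launch d f hf := by
    rw [List.mem_singleton] at hf
    subst hf
    have := d.2
    refine ⟨?_, ?_, ?_, ?_⟩ <;>
      simp [cycleRoute, cycleArrival, cycleDeparture, Sortie.singleLoop]
    omega
  retrieve d f hf := by
    rw [List.mem_singleton] at hf
    subst hf
    have := d.2
    refine ⟨?_, ?_, ?_, ?_⟩ <;>
      simp [cycleRoute, cycleArrival, cycleDeparture, Sortie.singleLoop, Sortie.finish] <;>
      first | omega | linarith
  fly d f hf := by
    rw [List.mem_singleton] at hf
    subst hf
    rw [duration_singleLoop]
  disjoint d := List.pairwise_singleton _ _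
  cover x := by
    rcases x with _ | _ | i | i
    · exact Or.inl ⟨0, by omega, by simp [cycleRoute]⟩
    · exact Or.inl ⟨m + 1, by omega, by simp [cycleRoute]⟩
    · exact Or.inl ⟨i + 1, by omega, by simp [cycleRoute]⟩
    · exact Or.inr ⟨i, _, List.mem_singleton_self _, by simp [Sortie.singleLoop_served]⟩

theorem cycleSolution_isCycle (hm : 1 ≤ m) :
    (cycleSolution h0 h1 hm).IsCycle := by
  intro p hp q hq h
  simp only [cycleSolution, cycleRoute] at hp hq h
  split_ifs at h <;> simp at h <;> omega

theorem cycleSolution_completionTime (hm : 1 ≤ m) :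
    (cycleSolution h0 h1 hm).completionTime = 1 + m + m * ε := by
  simp only [Solution.completionTime, cycleSolution, cycleDeparture]
  rw [if_neg (by omega)]
  push_cast
  ring

/-- The truck route that passes the sites once before and once after the remote node. -/
def doubleRoute (m p : ℕ) : LoopNode m :=
  if h : 1 ≤ p ∧ p ≤ m then site ⟨p - 1, by omega⟩ else if p = m + 1 then far
  else if h : m + 2 ≤ p ∧ p ≤ 2 * m + 1 then site ⟨p - m - 2, by omega⟩ else base

noncomputable def doubleTime (m : ℕ) (ε : ℝ) (p : ℕ) : ℝ :=
  if p ≤ m then p * ε else if p = m + 1 then m * ε + 1 / 2 else (p - 2) * ε + 1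

theorem doubleRoute_site {i : ℕ} (h : i < m) : doubleRoute m (i + 1) = site ⟨i, h⟩ := by
  rw [doubleRoute, dif_pos (by omega)]
  rfl

theorem doubleRoute_far : doubleRoute m (m + 1) = far := by
  rw [doubleRoute, dif_neg (by omega), if_pos rfl]

theorem doubleTime_succ {p : ℕ} (hp : p < 2 * m + 2) :
    doubleTime m ε (p + 1) = doubleTime m ε p +
      truckDist ε (doubleRoute m p) (doubleRoute m (p + 1)) := by
  unfold doubleTime
  rcases lt_trichotomy p m with h | rfl | h
  · rw [if_pos (by omega), if_pos (by omega), doubleRoute_site h, truckDist_of_near _ ?_ ?_ ?_]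
    · push_cast; ring
    · unfold doubleRoute
      split_ifs <;> first | omega | trivial
    · trivial
    · unfold doubleRoute
      split_ifs <;> simp <;> omega
  · rw [if_neg (by omega), if_pos rfl, if_pos le_rfl, doubleRoute_far, truckDist_far_right]
    unfold doubleRoute
    split_ifs <;> simp
    omega
  · rw [if_neg (by omega), if_neg (by omega), if_neg (by omega)]
    rcases (Nat.succ_le_of_lt h).eq_or_lt with rfl | h
    · rw [if_pos rfl, doubleRoute_far, truckDist_far_left]
      · push_cast; ring
      · unfold doubleRoute
        split_ifs <;> simp
        omega
    · rw [if_neg (by omega), truckDist_of_near]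
      · push_cast; ring
      · unfold doubleRoute
        split_ifs <;> first | omega | trivial
      · unfold doubleRoute
        split_ifs <;> first | omega | trivial
      · unfold doubleRoute
        split_ifs <;> simp <;> omega

/-- All drones fly while the truck travels to the remote node and back. -/
noncomputable def doubleSolution (hm : 1 ≤ m) :
    (loopInstance m h0 h1).Solution where
  n := 2 * m + 2
  route := doubleRoute m
  route_start := by simp [doubleRoute]
  route_end := by
    unfold doubleRoute
    split_ifs <;> first | omega | rfl
  route_mem p hp := by
    unfold doubleRoute
    split_ifs <;> simp
  route_arcs p hp := by
    unfold doubleRoute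
    split_ifs <;> simp <;> omega
  arrival := doubleTime m ε
  departure := doubleTime m ε
  arrival_zero := by simp [doubleTime]
  wait p hp := le_rfl
  travel p hp := doubleTime_succ hp
  flights d := [⟨Sortie.singleLoop (site d) (cust d), d + 1, m + 2 + d, (d + 1) * ε,
    (m + d) * ε + 1⟩]
  feasible d f hf := by
    rw [List.mem_singleton] at hf
    subst hf
    exact feasibleSortie_singleLoop d
  launch d f hf := by
    rw [List.mem_singleton] at hf
    subst hf
    have := d.2
    refine ⟨?_, ?_, ?_, ?_⟩ <;> simp [doubleRoute, doubleTime, Sortie.singleLoop]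
    omega
  retrieve d f hf := by
    rw [List.mem_singleton] at hf
    subst hf
    have := d.2
    have e : doubleTime m ε (m + 2 + d) = (m + d) * ε + 1 := by
      unfold doubleTime
      rw [if_neg (by omega), if_neg (by omega)]
      push_cast
      ring
    refine ⟨by dsimp only; omega, ?_, e.le, e.ge⟩
    simp only [doubleRoute, Sortie.singleLoop, Sortie.finish]
    split_ifs <;> first | omega | (congr; omega)
  fly d f hf := by
    rw [List.mem_singleton] at hf
    subst hf
    rw [duration_singleLoop]
    -- The truck is away from the site for `1 + (m - 1) * ε`, which covers the flight because `m ≥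
    -- 1`.
    have : (1 : ℝ) ≤ m := by exact_mod_cast hm
    nlinarith
  disjoint d := List.pairwise_singleton _ _
  cover x := by
    rcases x with _ | _ | i | i
    · exact Or.inl ⟨0, by omega, by simp [doubleRoute]⟩
    · exact Or.inl ⟨m + 1, by omega, by simp [doubleRoute]⟩
    · exact Or.inl ⟨i + 1, by omega, by simp [doubleRoute]⟩
    · exact Or.inr ⟨i, _, List.mem_singleton_self _, by simp [Sortie.singleLoop_served]⟩

theorem doubleSolution_completionTime (hm : 1 ≤ m) :
    (doubleSolution h0 h1 hm).completionTime = 1 + 2 * m * ε := by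
  simp only [Solution.completionTime, doubleSolution, doubleTime]
  rw [if_neg (by omega), if_neg (by omega)]
  push_cast
  ring

end Solutions

theorem one_le_tspmD (hm : 1 ≤ m) : 1 ≤ (loopInstance m h0 h1).tspmD :=
  (cycleSolution h0 h1 hm).le_tspmD fun S =>
    (one_le_travelTime S).trans S.travelTime_le_completionTime

theorem tspmD_le (hm : 1 ≤ m) : (loopInstance m h0 h1).tspmD ≤ 1 + 2 * m * ε :=
  doubleSolution_completionTime h0 h1 hm ▸ (doubleSolution h0 h1 hm).tspmD_le

theorem one_add_le_mCycle (hm : 1 ≤ m) : 1 + (m : ℝ) ≤ (loopInstance m h0 h1).mCycle :=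
  (cycleSolution h0 h1 hm).le_mCycle (cycleSolution_isCycle h0 h1 hm) one_add_le_of_isCycle

theorem mCycle_le (hm : 1 ≤ m) : (loopInstance m h0 h1).mCycle ≤ 1 + m + m * ε :=
  cycleSolution_completionTime h0 h1 hm ▸
    (cycleSolution h0 h1 hm).mCycle_le (cycleSolution_isCycle h0 h1 hm)

end loopInstance

/-! ### Instances in which a flight between hubs serves two customers -/

/-- Two hubs, `K` nodes visited by the truck, and `K` pairs of customers, one next to each hub. -/
inductive PathNode (K : ℕ) where
  | hub (σ : Bool)
  | far (j : Fin K)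
  | cust (σ : Bool) (j : Fin K)
  deriving DecidableEq, Fintype

namespace PathNode

variable {K : ℕ}

noncomputable def truckDist : PathNode K → PathNode K → ℝ
  | hub _, far _ => 1 / 2
  | far _, hub _ => 1 / 2
  | x, y => if x = y then 0 else 1

noncomputable def droneDist (ε : ℝ) : PathNode K → PathNode K → ℝ
  | hub σ, cust τ _ => if σ = τ then 1 / 2 else 1 / 2 + ε
  | cust τ _, hub σ => if σ = τ then 1 / 2 else 1 / 2 + ε
  | cust σ i, cust τ j => if i = j then (if σ = τ then 0 else ε) else 1
  | x, y => if x = y then 0 else 1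

theorem le_droneDist {ε : ℝ} (h1 : ε ≤ 1 / 4) {x y : PathNode K} (h : x ≠ y) :
    ε ≤ droneDist ε x y := by
  rcases x with σ | i | ⟨σ, i⟩ <;> rcases y with τ | j | ⟨τ, j⟩ <;> simp only [droneDist] <;>
    split_ifs <;> first | linarith | (exfalso; simp_all)

theorem half_le_droneDist_cust {ε : ℝ} (h0 : 0 < ε) {x : PathNode K} (hx : ∀ σ j, x ≠ cust σ j)
    (τ : Bool) (j : Fin K) : 1 / 2 ≤ droneDist ε x (cust τ j) := by
  rcases x with σ | i | ⟨σ, i⟩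
  · simp only [droneDist]
    split_ifs <;> linarith
  · rw [droneDist, if_neg (by simp)]
    · norm_num
    all_goals simp
  · exact absurd rfl (hx σ i)

theorem exists_eq_hub {ε : ℝ} {x : PathNode K} (hx : ∀ σ j, x ≠ cust σ j) {τ : Bool}
    {j : Fin K} (h : droneDist ε x (cust τ j) < 1) : ∃ σ, x = hub σ := by
  rcases x with σ | i | ⟨σ, i⟩
  · exact ⟨σ, rfl⟩
  · simp [droneDist] at h
  · exact absurd rfl (hx σ i)

theorem truckDist_symm (x y : PathNode K) : truckDist x y = truckDist y x := by
  rcases x with σ | i | ⟨σ, i⟩ <;> rcases y with τ | j | ⟨τ, j⟩ <;> simp only [truckDist, eq_comm]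

theorem droneDist_symm (ε : ℝ) (x y : PathNode K) : droneDist ε x y = droneDist ε y x := by
  rcases x with σ | i | ⟨σ, i⟩ <;> rcases y with τ | j | ⟨τ, j⟩ <;> simp only [droneDist, eq_comm]

theorem half_le_truckDist {x y : PathNode K} (h : x ≠ y) : 1 / 2 ≤ truckDist x y := by
  rcases x with σ | i | ⟨σ, i⟩ <;> rcases y with τ | j | ⟨τ, j⟩ <;> simp only [truckDist] <;>
    first | rfl | (split_ifs <;> first | contradiction | norm_num)

theorem truckDist_le (x y : PathNode K) : truckDist x y ≤ 1 := by
  rcases x with σ | i | ⟨σ, i⟩ <;> rcases y with τ | j | ⟨τ, j⟩ <;> simp only [truckDist] <;>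
    first | (split_ifs <;> norm_num) | norm_num

theorem droneDist_triangle {ε : ℝ} (h0 : 0 < ε) (h1 : ε ≤ 1 / 4) (x y z : PathNode K) :
    droneDist ε x z ≤ droneDist ε x y + droneDist ε y z := by
  rcases x with σ | i | ⟨σ, i⟩ <;> rcases y with τ | j | ⟨τ, j⟩ <;>
    rcases z with ρ | k | ⟨ρ, k⟩ <;> simp only [droneDist] <;>
    split_ifs <;> first | linarith | (exfalso; simp_all)

/-- Half the cost of a detour to a remote node. -/
noncomputable def visitCost : PathNode K → ℝ
  | far _ => 1 / 2
  | _ => 0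

theorem visitCost_nonneg (x : PathNode K) : 0 ≤ visitCost x := by
  cases x <;> norm_num [visitCost]

theorem visitCost_add_le {x y : PathNode K} (h : x ≠ y) :
    visitCost x + visitCost y ≤ truckDist x y := by
  rcases x with σ | i | ⟨σ, i⟩ <;> rcases y with τ | j | ⟨τ, j⟩ <;>
    simp only [truckDist, visitCost] <;>
    first | norm_num; done | (split_ifs <;> first | contradiction | norm_num)

end PathNode

open PathNode in
/-- The truck shuttles between the hubs via the remote nodes. The drone serves the two customers
of a pair on its way from one hub to the other, whereas a loop from a hub serves only one. -/
noncomputable abbrev pathInstance (K : ℕ) {ε : ℝ} (h0 : 0 < ε) (h1 : ε ≤ 1 / 4) :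
    TSPDInstance 1 where
  Node := PathNode K
  finite_node := inferInstance
  depot := hub false
  Ntr := {x | ∀ σ j, x ≠ cust σ j}
  Ndr := {x | ∃ σ j, x = cust σ j}
  depot_mem := by simp
  union_eq := by
    ext x
    simpa using em (∃ σ j, x = cust σ j)
  truckTime := truckDist
  truckTime_self i := by rcases i <;> simp [truckDist]
  truckTime_pos i j h := by linarith [half_le_truckDist h]
  truckTime_symm := truckDist_symm
  truckTime_triangle i j k := by
    by_cases hij : i = j
    · subst hij; rcases i <;> simp [truckDist]
    by_cases hjk : j = k
    · subst hjk; rcases j <;> simp [truckDist]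
    linarith [half_le_truckDist hij, half_le_truckDist hjk, truckDist_le i k]
  droneTime := droneDist ε
  droneTime_self i := by rcases i <;> simp [droneDist]
  droneTime_pos i j h := h0.trans_le (le_droneDist h1 h)
  droneTime_symm := droneDist_symm ε
  droneTime_triangle := droneDist_triangle h0 h1
  droneWeight := 1
  droneWeight_pos := one_pos
  payload _ := 0
  payload_nonneg _ := le_rfl
  battery := 1 + ε
  battery_pos := by linarith

namespace pathInstance

open PathNode TSPDInstance

variable {K : ℕ} {ε : ℝ} {h0 : 0 < ε} {h1 : ε ≤ 1 / 4}

theorem energy_eq (π : Sortie (PathNode K)) :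
    (pathInstance K h0 h1).energy π = (pathInstance K h0 h1).duration π := by
  simp [energy]

theorem duration_singleLoop (σ : Bool) (j : Fin K) :
    (pathInstance K h0 h1).duration (Sortie.singleLoop (hub σ) (cust σ j)) = 1 := by
  simp only [duration, Sortie.singleLoop, Finset.sum_range_succ]
  norm_num [droneDist]

theorem duration_pair (σ : Bool) (j : Fin K) :
    (pathInstance K h0 h1).duration
      (Sortie.pair (hub σ) (cust σ j) (cust (!σ) j) (hub !σ)) = 1 + ε := by
  simp only [duration, Sortie.pair, Finset.sum_range_succ]
  norm_num [droneDist]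
  ring

theorem feasibleSortie_singleLoop (σ : Bool) (j : Fin K) :
    (pathInstance K h0 h1).FeasibleSortie (Sortie.singleLoop (hub σ) (cust σ j)) where
  one_le := le_rfl
  start_mem := by simp [Sortie.singleLoop]
  finish_mem := by simp [Sortie.singleLoop, Sortie.finish]
  served_subset := by
    rw [Sortie.singleLoop_served]
    simp
  arcs q hq := by
    simp only [Sortie.singleLoop] at hq ⊢
    interval_cases q <;> simp
  energy_le := by
    rw [energy_eq, duration_singleLoop]
    exact le_add_of_nonneg_right h0.le

theorem feasibleSortie_pair (σ : Bool) (j : Fin K) :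
    (pathInstance K h0 h1).FeasibleSortie
      (Sortie.pair (hub σ) (cust σ j) (cust (!σ) j) (hub !σ)) where
  one_le := by simp [Sortie.pair]
  start_mem := by simp [Sortie.pair]
  finish_mem := by simp [Sortie.pair, Sortie.finish]
  served_subset := by
    rw [Sortie.pair_served]
    rintro _ (rfl | rfl) <;> simp
  arcs q hq := by
    simp only [Sortie.pair] at hq ⊢
    interval_cases q <;> simp
  energy_le := by rw [energy_eq, duration_pair]

/-- A feasible sortie lasts at least `1`, leaves from a hub, ends at a hub, and serves at most two
customers; only one if it is a loop. -/
theorem FeasibleSortie.bounds {π : Sortie (PathNode K)}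
    (h : (pathInstance K h0 h1).FeasibleSortie π) :
    1 ≤ (pathInstance K h0 h1).duration π ∧ (∃ σ, π.node 0 = hub σ) ∧ π.k ≤ 2 ∧
      (π.IsLoop → π.k ≤ 1) := by
  have hle : (pathInstance K h0 h1).duration π ≤ 1 + ε := by
    rw [← energy_eq]; exact h.energy_le
  obtain ⟨l, hl⟩ : ∃ l, π.k = l + 1 := ⟨π.k - 1, by have := h.one_le; omega⟩
  obtain ⟨α, i, hi⟩ : ∃ σ j, π.node 1 = cust σ j :=
    h.served_subset ⟨1, le_rfl, h.one_le, rfl⟩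
  obtain ⟨β, j, hj⟩ : ∃ σ j, π.node (l + 1) = cust σ j :=
    h.served_subset ⟨l + 1, by omega, hl.ge, rfl⟩
  have hs : ∀ σ j, π.node 0 ≠ cust σ j := h.start_mem
  have hf : ∀ σ j, π.node (l + 2) ≠ cust σ j := by
    have := h.finish_mem
    rwa [Sortie.finish, hl] at this
  have hsum : (pathInstance K h0 h1).duration π =
      ∑ q ∈ Finset.range l, droneDist ε (π.node (q + 1)) (π.node (q + 2)) +
        droneDist ε (π.node 0) (cust α i) + droneDist ε (π.node (l + 2)) (cust β j) := by
    rw [duration, hl, Finset.sum_range_succ, Finset.sum_range_succ', ← hi, ← hj,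
      droneDist_symm ε (π.node (l + 2))]
  have hmid : l * ε ≤ ∑ q ∈ Finset.range l, droneDist ε (π.node (q + 1)) (π.node (q + 2)) := by
    rw [← nsmul_eq_mul, ← Finset.card_range l, ← Finset.sum_const, Finset.card_range]
    exact Finset.sum_le_sum fun q hq => le_droneDist h1
      (h.arcs (q + 1) (by have := Finset.mem_range.1 hq; omega))
  have hds := half_le_droneDist_cust h0 hs α i
  have hdf := half_le_droneDist_cust h0 hf β j
  have hlε : 0 ≤ l * ε := by positivity
  -- The last leg takes at least 1/2, leaving at most `1/2 + ε < 1` for the first; from a remote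
  -- node it would take 1.
  obtain ⟨σ, hσ⟩ := exists_eq_hub hs (τ := α) (j := i) (ε := ε) (by linarith)
  have hl1 : l ≤ 1 := by
    have : (l : ℝ) * ε ≤ 1 * ε := by linarith
    exact_mod_cast le_of_mul_le_mul_right this h0
  refine ⟨by linarith, ⟨σ, hσ⟩, by omega, fun hloop => ?_⟩
  -- A loop with two customers is too long: if they form a pair, one is next to the other hub and
  -- the total is `1 + 2ε`; otherwise the middle leg alone takes 1 and the total is at least 2.
  by_contra hk
  obtain rfl : l = 1 := by omega
  have hfin : π.node 3 = hub σ := by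
    rw [Sortie.IsLoop, Sortie.finish, hl, hσ] at hloop
    exact hloop.symm
  have hne := h.arcs 1 (by omega)
  norm_num [hi, hj, hσ, hfin] at hsum hne
  simp only [droneDist] at hsum
  split_ifs at hsum <;> first | linarith | (exfalso; simp_all)

/-- The truck has to travel to all remote nodes. -/
theorem le_travelTime (S : (pathInstance K h0 h1).Solution) : K ≤ S.travelTime S.n := by
  have h := S.two_mul_sum_le_travelTime visitCost_nonneg (fun _ _ => visitCost_add_le)
    (Finset.univ.map ⟨far, fun i j h => by simpa using h⟩) (by simp)
  rw [Finset.sum_map] at h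
  have hsum : 2 * ∑ j : Fin K, visitCost (far j) = K := by
    simp [visitCost, mul_left_comm]
  exact hsum.symm.le.trans h

open Classical in
theorem le_of_isCycle (S : (pathInstance K h0 h1).Solution) (hS : S.IsCycle) :
    3 * (K : ℝ) - 4 ≤ S.completionTime := by
  -- `H p` collects the hub stays before position `p`. On a cycle there are at most two before
  -- `S.n`; the final return to the depot is excluded.
  set H : ℕ → Finset ℕ := fun p => (Finset.range p).filter fun q => ∃ σ, S.route q = hub σ with hH
  have hHmono : Monotone H := fun p q h =>
    Finset.filter_subset_filter _ (Finset.range_mono h)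
  have hHn : (H S.n).card ≤ 2 := by
    have hsub : (H S.n).image S.route ⊆ {hub false, hub true} := by
      intro x hx
      obtain ⟨q, hq, rfl⟩ := Finset.mem_image.1 hx
      obtain ⟨σ, hσ⟩ := (Finset.mem_filter.1 hq).2
      rw [hσ]
      cases σ <;> simp
    rw [← Finset.card_image_of_injOn (f := S.route)]
    · exact (Finset.card_le_card hsub).trans Finset.card_le_two
    · intro p hp q hq h
      simp only [hH, Finset.coe_filter, Finset.mem_range, Set.mem_ofPred_eq] at hp hq
      exact hS p hp.1 q hq.1 h
  -- The factor 2 is the largest number of customers in one sortie.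
  have hP : Monotone fun p => 2 * ((H p).card : ℝ) := fun p q h => by
    have : ((H p).card : ℝ) ≤ (H q).card := by exact_mod_cast Finset.card_le_card (hHmono h)
    dsimp only
    linarith
  have hsum := S.sum_flights_le 0 hP
  have hcard := S.card_le_sum_flights 0
    ((Finset.univ : Finset (Bool × Fin K)).map
      ⟨fun x => cust x.1 x.2, fun x y h => by simpa [Prod.ext_iff] using h⟩) (fun c hc => by
        obtain ⟨x, -, rfl⟩ := Finset.mem_map.1 hc
        obtain ⟨d, hd⟩ := S.exists_served (i := cust x.1 x.2) (by simp)
        rwa [Subsingleton.elim d 0] at hd)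
  have hle : ((S.flights 0).map fun f => (f.sortie.k : ℝ)).sum ≤ _ :=
    (List.sum_le_sum fun f hf => ?_).trans hsum
  · have hn : ((H S.n).card : ℝ) ≤ 2 := by exact_mod_cast hHn
    have h00 : H 0 = ∅ := by simp [hH]
    simp only [Finset.card_map, Finset.card_univ, Fintype.card_prod, Fintype.card_bool,
      Fintype.card_fin] at hcard
    push_cast at hcard
    rw [h00, Finset.card_empty] at hle
    push_cast at hle
    linarith [le_travelTime S]
  · obtain ⟨hdur, hhub, hk2, hk1⟩ := FeasibleSortie.bounds (S.feasible 0 f hf)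
    have hl := S.standsAt_launch hf
    have hr := S.standsAt_retrieve hf
    have hfly := S.fly 0 f hf
    -- Within one stay the flight is a loop: one customer, paid for by a unit of waiting. Otherwise
    -- the truck leaves the launching hub behind, which pays for two customers; this includes a
    -- flight from the initial to the final stay at the depot.
    rcases (hl.le_of_le hr (S.launchTime_le hf)).eq_or_lt with heq | hlt
    · have hloop : f.sortie.IsLoop := by
        rw [Sortie.IsLoop, ← (S.launch 0 f hf).2.1, ← (S.retrieve 0 f hf).2.1, heq]
      have : (f.sortie.k : ℝ) ≤ 1 := by exact_mod_cast hk1 hloop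
      rw [heq]
      linarith
    · have hcardlt : (H f.launchPos).card + 1 ≤ (H f.retrievePos).card := by
        refine Finset.card_lt_card ⟨hHmono hlt.le, fun hsub => ?_⟩
        have hmem : f.launchPos ∈ H f.retrievePos :=
          Finset.mem_filter.2 ⟨Finset.mem_range.2 hlt, by rwa [(S.launch 0 f hf).2.1]⟩
        exact absurd (Finset.mem_range.1 (Finset.mem_filter.1 (hsub hmem)).1) (lt_irrefl _)
      have h1 : ((H f.launchPos).card : ℝ) + 1 ≤ (H f.retrievePos).card := by
        exact_mod_cast hcardlt
      have h2 : (f.sortie.k : ℝ) ≤ 2 := by exact_mod_cast hk2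
      have h3 := hl.sub_travelTime_le hr (S.launchTime_le hf)
      linarith

end pathInstance

/-! ### Explicit solutions of the path instances -/

namespace pathInstance

open PathNode TSPDInstance

variable {K : ℕ} {ε : ℝ} {h0 : 0 < ε} {h1 : ε ≤ 1 / 4}

/-- The truck route that alternates between the hubs, via the remote nodes. -/
def shuttleRoute (K p : ℕ) : PathNode K :=
  if h : p % 2 = 1 ∧ p / 2 < K then far ⟨p / 2, h.2⟩ else hub (decide (p / 2 % 2 = 1))

theorem shuttleRoute_two_mul (j : ℕ) : shuttleRoute K (2 * j) = hub (decide (j % 2 = 1)) := by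
  rw [shuttleRoute, dif_neg (by omega), Nat.mul_div_cancel_left _ two_pos]

theorem shuttleRoute_two_mul_add_one {j : ℕ} (h : j < K) :
    shuttleRoute K (2 * j + 1) = far ⟨j, h⟩ := by
  have e : (2 * j + 1) / 2 = j := by omega
  rw [shuttleRoute, dif_pos (by omega)]
  simp [e]

noncomputable def shuttleArrival (ε : ℝ) (p : ℕ) : ℝ :=
  (p / 2 : ℕ) * (1 + ε) + if p % 2 = 1 then 1 / 2 else 0

/-- The wait of `ε` at each remote node stretches a trip between the hubs to `1 + ε`, the duration
of the drone's flight. -/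
noncomputable def shuttleDeparture (ε : ℝ) (p : ℕ) : ℝ :=
  (p / 2 : ℕ) * (1 + ε) + if p % 2 = 1 then 1 / 2 + ε else 0

theorem shuttleArrival_two_mul (j : ℕ) : shuttleArrival ε (2 * j) = j * (1 + ε) := by
  simp [shuttleArrival]

theorem shuttleDeparture_two_mul (j : ℕ) : shuttleDeparture ε (2 * j) = j * (1 + ε) := by
  simp [shuttleDeparture]

theorem shuttleArrival_two_mul_add_one (j : ℕ) :
    shuttleArrival ε (2 * j + 1) = j * (1 + ε) + 1 / 2 := by
  have e : (2 * j + 1) / 2 = j := by omega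
  rw [shuttleArrival, e, if_pos (by omega)]

theorem shuttleDeparture_two_mul_add_one (j : ℕ) :
    shuttleDeparture ε (2 * j + 1) = j * (1 + ε) + (1 / 2 + ε) := by
  have e : (2 * j + 1) / 2 = j := by omega
  rw [shuttleDeparture, e, if_pos (by omega)]

theorem shuttleArrival_succ {p : ℕ} (hp : p < 2 * K) :
    shuttleArrival ε (p + 1) = shuttleDeparture ε p +
      truckDist (shuttleRoute K p) (shuttleRoute K (p + 1)) := by
  obtain ⟨j, rfl | rfl⟩ := p.even_or_odd'
  · rw [shuttleArrival_two_mul_add_one, shuttleDeparture_two_mul, shuttleRoute_two_mul,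
      shuttleRoute_two_mul_add_one (by omega), truckDist]
  · rw [show 2 * j + 1 + 1 = 2 * (j + 1) by ring, shuttleArrival_two_mul,
      shuttleDeparture_two_mul_add_one, shuttleRoute_two_mul,
      shuttleRoute_two_mul_add_one (by omega), truckDist]
    push_cast
    ring

/-- The flight past the `j`-th pair of customers, from one hub to the other. -/
noncomputable def shuttleFlight (ε : ℝ) (j : Fin K) : Flight (PathNode K) where
  sortie := Sortie.pair (hub (decide (j.1 % 2 = 1))) (cust (decide (j.1 % 2 = 1)) j)
    (cust (!decide (j.1 % 2 = 1)) j) (hub !decide (j.1 % 2 = 1))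
  launchPos := 2 * j
  retrievePos := 2 * (j + 1)
  launchTime := j * (1 + ε)
  retrieveTime := (j + 1) * (1 + ε)

section Solutions

variable (h0 h1)

/-- The drone serves one pair of customers during every trip of the truck between the hubs. -/
noncomputable def shuttleSolution (hK : 1 ≤ K) (heven : Even K) :
    (pathInstance K h0 h1).Solution where
  n := 2 * K
  route := shuttleRoute K
  route_start := rfl
  route_end := by
    -- After `K` trips the truck is back at the depot because `K` is even.
    rw [shuttleRoute_two_mul, Nat.even_iff.1 heven]
    rfl
  route_mem p hp := by
    unfold shuttleRoute
    split_ifs <;> simp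
  route_arcs p hp := by
    unfold shuttleRoute
    split_ifs <;> simp <;> omega
  arrival := shuttleArrival ε
  departure := shuttleDeparture ε
  arrival_zero := by simp [shuttleArrival]
  wait p hp := by
    unfold shuttleArrival shuttleDeparture
    split_ifs <;> linarith
  travel p hp := shuttleArrival_succ hp
  flights _ := (List.finRange K).map (shuttleFlight ε)
  feasible d f hf := by
    obtain ⟨j, -, rfl⟩ := List.mem_map.1 hf
    exact feasibleSortie_pair _ j
  launch d f hf := by
    obtain ⟨j, -, rfl⟩ := List.mem_map.1 hf
    exact ⟨by simp only [shuttleFlight]; omega, shuttleRoute_two_mul _,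
      (shuttleArrival_two_mul _).le, (shuttleDeparture_two_mul _).ge⟩
  retrieve d f hf := by
    obtain ⟨j, -, rfl⟩ := List.mem_map.1 hf
    refine ⟨by simp only [shuttleFlight]; omega, (shuttleRoute_two_mul _).trans ?_,
      (shuttleArrival_two_mul _).le.trans ?_, le_trans ?_ (shuttleDeparture_two_mul _).ge⟩
    · simp only [shuttleFlight, Sortie.finish, Sortie.pair]
      rcases Nat.mod_two_eq_zero_or_one j with h | h <;> simp [Nat.add_mod, h]
    · simp [shuttleFlight]
    · simp [shuttleFlight]
  fly d f hf := by
    obtain ⟨j, -, rfl⟩ := List.mem_map.1 hf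
    rw [shuttleFlight, duration_pair]
    exact le_of_eq (by ring)
  disjoint d := by
    rw [List.pairwise_map]
    refine (List.pairwise_lt_finRange K).imp fun {i j} hij => ?_
    have : ((i : ℕ) : ℝ) + 1 ≤ (j : ℕ) := by exact_mod_cast hij
    exact mul_le_mul_of_nonneg_right this (by linarith)
  cover x := by
    rcases x with σ | j | ⟨σ, j⟩
    · refine Or.inl ⟨2 * (if σ then 1 else 0), by split_ifs <;> omega, ?_⟩
      rw [shuttleRoute_two_mul]
      cases σ <;> simp
    · exact Or.inl ⟨2 * j + 1, by omega, shuttleRoute_two_mul_add_one j.2⟩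
    · refine Or.inr ⟨0, _, List.mem_map_of_mem (List.mem_finRange j), ?_⟩
      rw [shuttleFlight, Sortie.pair_served]
      rcases Nat.mod_two_eq_zero_or_one j with h | h <;> cases σ <;> simp [h]

theorem shuttleSolution_completionTime (hK : 1 ≤ K) (heven : Even K) :
    (shuttleSolution h0 h1 hK heven).completionTime = K * (1 + ε) :=
  shuttleDeparture_two_mul K

/-- The truck route through all remote nodes and the other hub. -/
def tourRoute (K p : ℕ) : PathNode K :=
  if h : 1 ≤ p ∧ p ≤ K then far ⟨p - 1, by omega⟩ else hub (decide (p = K + 1))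

theorem tourRoute_far {i : ℕ} (h : i < K) : tourRoute K (i + 1) = far ⟨i, h⟩ := by
  rw [tourRoute, dif_pos (by omega)]
  rfl

/-- The truck waits `K` units at each hub, one per loop, and travels directly from one remote node
to the next. -/
noncomputable def tourArrival (K p : ℕ) : ℝ :=
  if p = 0 then 0 else if p ≤ K then K + p - 1 / 2 else if p = K + 1 then 2 * K else 3 * K + 1

noncomputable def tourDeparture (K p : ℕ) : ℝ :=
  if p = 0 then K else if p ≤ K then K + p - 1 / 2 else if p = K + 1 then 3 * K else 3 * K + 1

theorem tourArrival_succ (hK : 1 ≤ K) {p : ℕ} (hp : p < K + 2) :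
    tourArrival K (p + 1) = tourDeparture K p +
      truckDist (tourRoute K p) (tourRoute K (p + 1)) := by
  unfold tourArrival tourDeparture
  rw [if_neg (by omega)]
  rcases p with _ | p
  · rw [if_pos hK, if_pos rfl, tourRoute_far hK, tourRoute, dif_neg (by omega), truckDist]
    push_cast
    ring
  rw [if_neg p.succ_ne_zero]
  rcases lt_trichotomy (p + 1) K with h | h | h
  · rw [if_pos (Nat.succ_le_of_lt h), if_pos h.le, tourRoute_far h, tourRoute_far (by omega), truckDist,
      if_neg (by simp)]
    · push_cast
      ring
    all_goals simp
  · rw [if_neg (by omega), if_pos (by omega), if_pos h.le, tourRoute_far (by omega), tourRoute,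
      dif_neg (by omega), truckDist, ← h]
    push_cast
    ring
  · obtain rfl : p = K := by omega
    rw [if_neg (by omega), if_neg (by omega), if_neg (by omega), if_pos rfl, tourRoute,
      dif_neg (by omega), tourRoute, dif_neg (by omega), truckDist, if_neg (by simp)]
    all_goals simp

/-- The loop from hub `σ` to the `j`-th customer next to it. -/
noncomputable def tourFlight (σ : Bool) (j : Fin K) : Flight (PathNode K) where
  sortie := Sortie.singleLoop (hub σ) (cust σ j)
  launchPos := if σ then K + 1 else 0
  retrievePos := if σ then K + 1 else 0
  launchTime := (if σ then 2 * K else 0) + j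
  retrieveTime := (if σ then 2 * K else 0) + j + 1

theorem mem_tourFlights {f : Flight (PathNode K)}
    (hf : f ∈ (List.finRange K).map (tourFlight false) ++ (List.finRange K).map (tourFlight true)) :
    ∃ σ j, f = tourFlight σ j := by
  simp only [List.mem_append, List.mem_map] at hf
  rcases hf with ⟨j, -, rfl⟩ | ⟨j, -, rfl⟩ <;> exact ⟨_, j, rfl⟩

theorem pairwise_tourFlights (σ : Bool) : ((List.finRange K).map (tourFlight σ)).Pairwise
    fun f g => f.retrieveTime ≤ g.launchTime := by
  rw [List.pairwise_map]
  refine (List.pairwise_lt_finRange K).imp fun {i j} hij => ?_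
  have : ((i : ℕ) : ℝ) + 1 ≤ (j : ℕ) := by exact_mod_cast hij
  simp only [tourFlight]
  linarith

theorem standsAt_tourFlight (σ : Bool) (j : Fin K) :
    (tourFlight σ j).launchPos ≤ K + 2 ∧ tourRoute K (tourFlight σ j).launchPos = hub σ ∧
      tourArrival K (tourFlight σ j).launchPos ≤ (tourFlight σ j).launchTime ∧
      (tourFlight σ j).retrieveTime ≤ tourDeparture K (tourFlight σ j).launchPos := by
  have : ((j : ℕ) : ℝ) + 1 ≤ K := by exact_mod_cast j.2
  cases σ <;> simp [tourFlight, tourRoute, tourArrival, tourDeparture] <;> linarith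

/-- The drone performs loops while the truck waits at the hubs. -/
noncomputable def tourSolution (hK : 1 ≤ K) : (pathInstance K h0 h1).Solution where
  n := K + 2
  route := tourRoute K
  route_start := by simp [tourRoute]
  route_end := by simp [tourRoute]
  route_mem p hp := by
    unfold tourRoute
    split_ifs <;> simp
  route_arcs p hp := by
    unfold tourRoute
    split_ifs <;> simp <;> omega
  arrival := tourArrival K
  departure := tourDeparture K
  arrival_zero := by simp [tourArrival]
  wait p hp := by
    unfold tourArrival tourDeparture
    split_ifs <;> first | exact le_rfl | positivity | linarith
  travel p hp := tourArrival_succ hK hp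
  flights _ := (List.finRange K).map (tourFlight false) ++ (List.finRange K).map (tourFlight true)
  feasible d f hf := by
    obtain ⟨σ, j, rfl⟩ := mem_tourFlights hf
    exact feasibleSortie_singleLoop _ j
  launch d f hf := by
    obtain ⟨σ, j, rfl⟩ := mem_tourFlights hf
    obtain ⟨ha, hb, hc, hd⟩ := standsAt_tourFlight σ j
    exact ⟨ha, hb, hc, le_trans (by simp [tourFlight]) hd⟩
  retrieve d f hf := by
    obtain ⟨σ, j, rfl⟩ := mem_tourFlights hf
    obtain ⟨ha, hb, hc, hd⟩ := standsAt_tourFlight σ j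
    exact ⟨ha, hb, hc.trans (by simp [tourFlight]), hd⟩
  fly d f hf := by
    obtain ⟨σ, j, rfl⟩ := mem_tourFlights hf
    rw [tourFlight, duration_singleLoop]
  disjoint d := by
    refine List.pairwise_append.2 ⟨pairwise_tourFlights _, pairwise_tourFlights _, ?_⟩
    intro f hf g hg
    obtain ⟨i, -, rfl⟩ := List.mem_map.1 hf
    obtain ⟨j, -, rfl⟩ := List.mem_map.1 hg
    have : ((i : ℕ) : ℝ) + 1 ≤ K := by exact_mod_cast i.2
    have : (0 : ℝ) ≤ (j : ℕ) := Nat.cast_nonneg _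
    simp [tourFlight]
    linarith
  cover x := by
    rcases x with σ | j | ⟨σ, j⟩
    · refine Or.inl ⟨if σ then K + 1 else 0, by split_ifs <;> omega, ?_⟩
      cases σ <;> simp [tourRoute]
    · exact Or.inl ⟨j + 1, by omega, tourRoute_far j.2⟩
    · refine Or.inr ⟨0, tourFlight σ j, ?_, by simp [tourFlight, Sortie.singleLoop_served]⟩
      cases σ <;> simp

theorem tourSolution_isCycle (hK : 1 ≤ K) : (tourSolution h0 h1 hK).IsCycle := by
  intro p hp q hq h
  simp only [tourSolution, tourRoute] at hp hq h
  split_ifs at h <;> simp at h <;> omega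

theorem tourSolution_completionTime (hK : 1 ≤ K) :
    (tourSolution h0 h1 hK).completionTime = 3 * K + 1 := by
  simp [Solution.completionTime, tourSolution, tourDeparture]

end Solutions

theorem le_tspmD (hK : 1 ≤ K) : K ≤ (pathInstance K h0 h1).tspmD :=
  (tourSolution h0 h1 hK).le_tspmD fun S =>
    (le_travelTime S).trans S.travelTime_le_completionTime

theorem tspmD_le (hK : 1 ≤ K) (heven : Even K) :
    (pathInstance K h0 h1).tspmD ≤ K * (1 + ε) :=
  shuttleSolution_completionTime h0 h1 hK heven ▸ (shuttleSolution h0 h1 hK heven).tspmD_le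

theorem le_mCycle (hK : 1 ≤ K) : 3 * (K : ℝ) - 4 ≤ (pathInstance K h0 h1).mCycle :=
  (tourSolution h0 h1 hK).le_mCycle (tourSolution_isCycle h0 h1 hK) le_of_isCycle

theorem mCycle_le (hK : 1 ≤ K) : (pathInstance K h0 h1).mCycle ≤ 3 * K + 1 :=
  tourSolution_completionTime h0 h1 hK ▸
    (tourSolution h0 h1 hK).mCycle_le (tourSolution_isCycle h0 h1 hK)

end pathInstance

/-! ### Limits of the ratios -/

open TSPDInstance

theorem exists_tendsto_ratio_three : ∃ I : ℕ → TSPDInstance 1,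
    (∀ k, 0 < (I k).tspmD) ∧
    Tendsto (fun k => (I k).mCycle / (I k).tspmD) atTop (𝓝 (1 + 2 * 1)) := by
  have h0 : ∀ k : ℕ, (0 : ℝ) < 1 / (k + 4) := fun k => by positivity
  have h1 : ∀ k : ℕ, 1 / ((k : ℝ) + 4) ≤ 1 / 4 := fun k =>
    one_div_le_one_div_of_le (by norm_num) (by linarith [Nat.cast_nonneg (α := ℝ) k])
  have hK : ∀ k : ℕ, 1 ≤ 2 * (k + 1) := fun k => by omega
  have hpos : ∀ k : ℕ, (0 : ℝ) < (2 * (k + 1) : ℕ) := fun k => by positivity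
  have hε : Tendsto (fun k : ℕ => 1 / ((k : ℝ) + 4)) atTop (𝓝 0) := by
    exact_mod_cast (tendsto_add_atTop_iff_nat 4).2 (tendsto_one_div_atTop_nhds_zero_nat (𝕜 := ℝ))
  have hK' : Tendsto (fun k : ℕ => 1 / ((2 * (k + 1) : ℕ) : ℝ)) atTop (𝓝 0) :=
    tendsto_one_div_atTop_nhds_zero_nat.comp
      (tendsto_atTop_mono (fun k => by dsimp only [id]; omega) tendsto_id)
  refine ⟨fun k => pathInstance (2 * (k + 1)) (h0 k) (h1 k),
    fun k => (hpos k).trans_le (pathInstance.le_tspmD (hK k)), ?_⟩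
  refine tendsto_of_tendsto_of_tendsto_of_le_of_le
    (g := fun k : ℕ => (3 - 4 * (1 / ((2 * (k + 1) : ℕ) : ℝ))) / (1 + 1 / ((k : ℝ) + 4)))
    (h := fun k : ℕ => 3 + 1 / ((2 * (k + 1) : ℕ) : ℝ)) ?_ ?_ (fun k => ?_) (fun k => ?_)
  · have := (tendsto_const_nhds (x := (3 : ℝ)).sub (hK'.const_mul 4)).div
      (hε.const_add 1) (by norm_num)
    rw [show ((3 : ℝ) - 4 * 0) / (1 + 0) = 1 + 2 * 1 by norm_num] at this
    exact this
  · convert hK'.const_add 3 using 2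
    norm_num
  · have hp := hpos k
    have hl := pathInstance.le_mCycle (h0 := h0 k) (h1 := h1 k) (hK k)
    have hu := pathInstance.tspmD_le (h0 := h0 k) (h1 := h1 k) (hK k) (even_two_mul _)
    have ht := pathInstance.le_tspmD (h0 := h0 k) (h1 := h1 k) (hK k)
    have hd : 0 < 1 + 1 / ((k : ℝ) + 4) := by linarith [h0 k]
    have h2 : (2 : ℝ) ≤ (2 * (k + 1) : ℕ) := by push_cast; linarith [Nat.cast_nonneg (α := ℝ) k]
    -- The sign is needed to multiply the upper bound on `tspmD` by this factor; it holds since `K ≥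
    -- 2`.
    have h4 : (0 : ℝ) ≤ 3 - 4 * (1 / (2 * (k + 1) : ℕ)) := by
      linarith [one_div_le_one_div_of_le two_pos h2]
    rw [div_le_div_iff₀ hd (hp.trans_le ht)]
    calc _ ≤ (3 - 4 * (1 / ((2 * (k + 1) : ℕ) : ℝ))) *
          (((2 * (k + 1) : ℕ) : ℝ) * (1 + 1 / ((k : ℝ) + 4))) := mul_le_mul_of_nonneg_left hu h4
      _ = (3 * ((2 * (k + 1) : ℕ) : ℝ) - 4) * (1 + 1 / ((k : ℝ) + 4)) := by
        field_simp
      _ ≤ _ := mul_le_mul_of_nonneg_right hl hd.le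
  · have hp := hpos k
    have hl := pathInstance.mCycle_le (h0 := h0 k) (h1 := h1 k) (hK k)
    have ht := pathInstance.le_tspmD (h0 := h0 k) (h1 := h1 k) (hK k)
    rw [div_le_iff₀ (hp.trans_le ht)]
    calc _ ≤ 3 * ((2 * (k + 1) : ℕ) : ℝ) + 1 := hl
      _ = (3 + 1 / ((2 * (k + 1) : ℕ) : ℝ)) * ((2 * (k + 1) : ℕ) : ℝ) := by field_simp
      _ ≤ _ := mul_le_mul_of_nonneg_left ht (by positivity)

theorem exists_tendsto_ratio_two : ∃ I : ℕ → TSPDInstance 1,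
    (∀ k, (I k).LoopOrSingle) ∧ (∀ k, 0 < (I k).tspmD) ∧
    Tendsto (fun k => (I k).mCycle / (I k).tspmD) atTop (𝓝 (1 + 1)) := by
  have h0 : ∀ k : ℕ, (0 : ℝ) < 1 / (k + 2) := fun k => by positivity
  have h1 : ∀ k : ℕ, 1 / ((k : ℝ) + 2) ≤ 1 / 2 := fun k =>
    one_div_le_one_div_of_le (by norm_num) (by linarith [Nat.cast_nonneg (α := ℝ) k])
  have hε : Tendsto (fun k : ℕ => 1 / ((k : ℝ) + 2)) atTop (𝓝 0) := by
    exact_mod_cast (tendsto_add_atTop_iff_nat 2).2 (tendsto_one_div_atTop_nhds_zero_nat (𝕜 := ℝ))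
  refine ⟨fun k => loopInstance 1 (h0 k) (h1 k), fun k => loopInstance.loopOrSingle,
    fun k => one_pos.trans_le (loopInstance.one_le_tspmD le_rfl), ?_⟩
  refine tendsto_of_tendsto_of_tendsto_of_le_of_le
    (g := fun k : ℕ => 2 / (1 + 2 * (1 / ((k : ℝ) + 2))))
    (h := fun k : ℕ => 2 + 1 / ((k : ℝ) + 2)) ?_ ?_ (fun k => ?_) (fun k => ?_)
  · have := (tendsto_const_nhds (x := (2 : ℝ))).div ((hε.const_mul 2).const_add 1) (by norm_num)
    rw [show (2 : ℝ) / (1 + 2 * 0) = 1 + 1 by norm_num] at this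
    exact this
  · convert hε.const_add 2 using 2
    norm_num
  · have hl := loopInstance.one_add_le_mCycle (h0 := h0 k) (h1 := h1 k) le_rfl
    have hu := loopInstance.tspmD_le (h0 := h0 k) (h1 := h1 k) le_rfl
    have ht := loopInstance.one_le_tspmD (h0 := h0 k) (h1 := h1 k) le_rfl
    push_cast at hl hu
    exact div_le_div₀ (by linarith) (by linarith) (by linarith) (by linarith)
  · have hl := loopInstance.mCycle_le (h0 := h0 k) (h1 := h1 k) le_rfl
    have ht := loopInstance.one_le_tspmD (h0 := h0 k) (h1 := h1 k) le_rfl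
    push_cast at hl
    exact (div_le_div₀ (by linarith [h0 k]) hl one_pos ht).trans (by rw [div_one]; linarith)

theorem exists_le_ratio {m : ℕ} (hm : 1 ≤ m) :
    ∃ I : TSPDInstance m, 0 < I.tspmD ∧ (m : ℝ) ≤ I.mCycle / I.tspmD := by
  have hm' : (1 : ℝ) ≤ m := by exact_mod_cast hm
  -- With `ε = 1 / (2m²)` the bound `m * (1 + 2mε)` equals `1 + m`, the lower bound for cycles.
  have h0 : (0 : ℝ) < 1 / (2 * m * m) := by positivity
  have h1 : (1 : ℝ) / (2 * m * m) ≤ 1 / 2 :=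
    one_div_le_one_div_of_le (by norm_num) (by nlinarith)
  have ht : 0 < (loopInstance m h0 h1).tspmD := one_pos.trans_le (loopInstance.one_le_tspmD hm)
  refine ⟨loopInstance m h0 h1, ht, (le_div_iff₀ ht).2 ?_⟩
  calc m * (loopInstance m h0 h1).tspmD ≤ m * (1 + 2 * m * (1 / (2 * m * m))) :=
        mul_le_mul_of_nonneg_left (loopInstance.tspmD_le hm) (by linarith)
    _ = 1 + m := by field_simp; ring
    _ ≤ _ := loopInstance.one_add_le_mCycle hm

theorem mainTheorem7 :
    (∃ I : ℕ → TSPDInstance 1,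
      (∀ k, 0 < (I k).tspmD) ∧
      Tendsto (fun k => (I k).mCycle / (I k).tspmD) atTop (𝓝 (1 + 2 * 1))) ∧
    (∃ I : ℕ → TSPDInstance 1,
      (∀ k, (I k).LoopOrSingle) ∧
      (∀ k, 0 < (I k).tspmD) ∧
      Tendsto (fun k => (I k).mCycle / (I k).tspmD) atTop (𝓝 (1 + 1))) ∧
    (∀ m : ℕ, 1 ≤ m →
      ∃ I : TSPDInstance m, 0 < I.tspmD ∧ (m : ℝ) ≤ I.mCycle / I.tspmD) :=
  ⟨exists_tendsto_ratio_three, exists_tendsto_ratio_two, fun _ hm => exists_le_ratio hm⟩
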